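/- For a finite simple graph $G$ on $n$ vertices with Laplacian eigenvalues $\mu_1\ge\dots\ge\mu_n$ and average degree $\overline d$, the Laplacian energy is $LE(G)=\sum_{i=1}^n|\mu_i-\overline d|$. Let $\mathcal S_{n,k}$ be the family of $n$-vertex trees consisting of a central vertex $u$ that is adjacent to one end of each of $h\ge 3$ disjoint paths with $a_1,\dots,a_h\ge 1$ vertices, where $a_i$ is even for $1\le i\le h-1$, $a_1=a_2=k\ge 2$, and $a_h<n/2$ is odd. Let $G\in\mathcal S_{n,k}$. Then $G$ can be obtained from two disjoint copies of the path $P_k$, whose vertices are labeled $1,\dots,k$ in increasing order along the path, and an $(n-2k)$-vertex graph $\breve G$ rooted at the central vertex $u$, by joining $u$ to the two copies of vertex $k$. For every such decomposition of $G$, let $\mathcal E_{e_1}(G)$ be the graph obtained from $G$ by adding the edge that joins the two copies of vertex $1$ of $P_k$. Then $$LE(G)=LE(\mathcal E_{e_1}(G)).$$ -/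

import Mathlib

/-- The average degree of a finite graph (`0` if there are no vertices). -/
noncomputable def averageDegree {V : Type*} [Fintype V] (G : SimpleGraph V) : ℝ :=
  open Classical in (∑ v : V, (G.degree v : ℝ)) / (Fintype.card V : ℝ)

/-- The eigenvalues of the Laplacian matrix `L = D - A` of `G`, listed with multiplicity. -/
noncomputable def lapEigenvalues {V : Type*} [Fintype V] (G : SimpleGraph V) : V → ℝ :=
  open Classical in (G.posSemidef_lapMatrix ℝ).isHermitian.eigenvalues

/-- The Laplacian energy: the sum over all Laplacian eigenvalues `μ` of `|μ - d|`, with `d` the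
average degree. -/
noncomputable def laplacianEnergy {V : Type*} [Fintype V] (G : SimpleGraph V) : ℝ :=
  ∑ i : V, |lapEigenvalues G i - averageDegree G|

/-- The graph `G(G*, Ğ, y)`: two disjoint copies of `G*` (first and second summand of the vertex
type) and one copy of `Ğ` (third summand), with the root `u` of `Ğ` joined to both copies of the
vertex `i` of `G*` if and only if `y i = 1`. -/
def twoCopyGraph {k : ℕ} {B : Type*} (Gstar : SimpleGraph (Fin k)) (Gbreve : SimpleGraph B)
    (u : B) (y : Fin k → Fin 2) : SimpleGraph (Fin k ⊕ Fin k ⊕ B) :=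
  SimpleGraph.fromRel fun p q =>
    match p, q with
    | .inl i, .inl j => Gstar.Adj i j
    | .inr (.inl i), .inr (.inl j) => Gstar.Adj i j
    | .inr (.inr b), .inr (.inr c) => Gbreve.Adj b c
    | .inr (.inr b), .inl i => b = u ∧ y i = 1
    | .inr (.inr b), .inr (.inl i) => b = u ∧ y i = 1
    | _, _ => False

/-- The edges joining the two copies of vertex `i` for each `i` with `z i = 1`. -/
def copyEdges {k : ℕ} (B : Type*) (z : Fin k → Fin 2) : SimpleGraph (Fin k ⊕ Fin k ⊕ B) :=
  SimpleGraph.fromRel fun p q =>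
    match p, q with
    | .inl i, .inr (.inl j) => i = j ∧ z i = 1
    | _, _ => False

/-- A way to view the graph `G` as a member `G(G*, Ğ, y)` of the family `W_{n,k}`. The existence of
the root forces `2 * k < n`. -/
structure WDecomposition (n k : ℕ) {V : Type*} (G : SimpleGraph V) where
  k_pos : 0 < k
  Gstar : SimpleGraph (Fin k)
  Gbreve : SimpleGraph (Fin (n - 2 * k))
  root : Fin (n - 2 * k)
  y : Fin k → Fin 2
  iso : twoCopyGraph Gstar Gbreve root y ≃g G

/-- The operation `E_z`: for every `i` with `z i = 1`, insert into `G` the edge between the two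
copies of the vertex `i` of `G*`. -/
def WDecomposition.opE {n k : ℕ} {V : Type*} {G : SimpleGraph V} (d : WDecomposition n k G)
    (z : Fin k → Fin 2) : SimpleGraph V :=
  G ⊔ (copyEdges (Fin (n - 2 * k)) z).map d.iso.toEquiv.toEmbedding

/-- The canonical vector `e_j` of `{0,1}^k`, where `j` runs from `1` to `k`. -/
def canonicalVector (k j : ℕ) : Fin k → Fin 2 :=
  fun i => if (i : ℕ) + 1 = j then 1 else 0

/-- The tree with a central vertex `none` that is adjacent to one end of each of `h` disjoint paths,
the `i`-th of which has the `a i` vertices `some ⟨i, 0⟩, some ⟨i, 1⟩, …`, in this order. -/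
def starlikeTree {h : ℕ} (a : Fin h → ℕ) : SimpleGraph (Option (Σ i : Fin h, Fin (a i))) :=
  SimpleGraph.fromRel fun p q =>
    match p, q with
    | none, some ⟨_, j⟩ => (j : ℕ) = 0
    | some ⟨i, j⟩, some ⟨i', j'⟩ => i = i' ∧ (j : ℕ) + 1 = (j' : ℕ)
    | _, _ => False

/-- The family `S_{n,k}`: `n`-vertex starlike trees with `h ≥ 3` branches of `a_1, …, a_h ≥ 1`
vertices (here indexed from `0`), where `a_1 = a_2 = k ≥ 2`, all of `a_1, …, a_{h-1}` are even, and
`a_h` is odd and less than `n / 2`. -/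
def MemS (n k : ℕ) {V : Type*} [Fintype V] (G : SimpleGraph V) : Prop :=
  Fintype.card V = n ∧ 2 ≤ k ∧
    ∃ (h : ℕ) (hh : 3 ≤ h) (a : Fin h → ℕ),
      (∀ i, 1 ≤ a i) ∧
      (∀ i : Fin h, (i : ℕ) < h - 1 → Even (a i)) ∧
      a ⟨0, by omega⟩ = k ∧ a ⟨1, by omega⟩ = k ∧
      Odd (a ⟨h - 1, by omega⟩) ∧ (a ⟨h - 1, by omega⟩ : ℝ) < (n : ℝ) / 2 ∧
      Nonempty (starlikeTree a ≃g G)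

/-- The decomposition of a member `G` of `S_{n,k}`: `G*` is the path `P_k` labeled in increasing
order along the path, `Ğ` is rooted at the central vertex of `G` (the one of degree larger than
two), and the adjacency vector is `e_k`. -/
def WDecomposition.IsStarlike {n k : ℕ} {V : Type*} {G : SimpleGraph V}
    (d : WDecomposition n k G) : Prop :=
  d.Gstar = SimpleGraph.pathGraph k ∧ d.y = canonicalVector k k ∧
    2 < (G.neighborSet (d.iso (.inr (.inr d.root)))).encard

/-!
Write `n = 2 * N`; the average degree of `G` is `2 - 1 / N`. The tree `G` has a perfect matching,
and on the vectors `x` with `x p + x q = 0` for each of its `N` edges `p q` the Laplacian form is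
at least `2 * ‖x‖ ^ 2`, so `N` eigenvalues are at least `2`. On another subspace of codimension
`N` the form is at most `(2 - 1 / N) * ‖x‖ ^ 2`, so the other `N` eigenvalues are at most
`2 - 1 / N`. As equally many eigenvalues lie on either side of the gap, the energy of `G` is also
the sum of the `|μ - 2|`.

The new edge raises the average degree to exactly `2` and makes all vertices of the two copies of
the path have degree `2`, so that `L - 2` is minus the adjacency matrix there. Since the path is
bipartite, swapping the two copies along one colour class shows that the new `L - 2` is, up to
conjugation by a permutation, the old one times the exchange `τ` of the two copies. As `τ`
commutes with the old `L`, both have the same square up to conjugation, hence the same sum of the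
`|μ - 2|`.
-/

section Eigenvalues

open Matrix QuadraticMap QuadraticForm

variable {V : Type*} [Fintype V] [DecidableEq V] {A : Matrix V V ℝ}

theorem toQuadraticForm'_sub_scalar_apply (A : Matrix V V ℝ) (c : ℝ) (x : V → ℝ) :
    (A - scalar V c).toQuadraticForm' x = x ⬝ᵥ A *ᵥ x - c * (x ⬝ᵥ x) := by
  simp only [toQuadraticForm', LinearMap.BilinMap.toQuadraticMap_apply, toLinearMap₂'_apply',
    sub_mulVec, dotProduct_sub, scalar_apply, ← smul_one_eq_diagonal, Matrix.smul_mulVec,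
    one_mulVec, dotProduct_smul, smul_eq_mul]

theorem equivalent_weightedSumSquares_eigenvalues_sub (hA : A.IsHermitian) (c : ℝ) :
    (A - scalar V c).toQuadraticForm'.Equivalent
      (weightedSumSquares ℝ fun i => hA.eigenvalues i - c) := by
  set U := hA.eigenvectorUnitary with hU
  have hone : U.1 * star U.1 = 1 := Unitary.mul_star_self_of_mem U.2
  have hspec : A = U.1 * diagonal hA.eigenvalues * star U.1 := by
    simpa [Unitary.conjStarAlgAut_apply, ← hU] using hA.spectral_theorem
  have conj (M : Matrix V V ℝ) (x : V → ℝ) :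
      x ⬝ᵥ (U.1 * M * star U.1) *ᵥ x = (star U.1 *ᵥ x) ⬝ᵥ M *ᵥ (star U.1 *ᵥ x) := by
    rw [star_eq_conjTranspose, conjTranspose_eq_transpose_of_trivial, mulVec_transpose U.1 x,
      ← dotProduct_mulVec, ← mulVec_transpose, mulVec_mulVec, mulVec_mulVec, Matrix.mul_assoc]
  refine ⟨⟨UnitaryGroup.toLinearEquiv (star U), fun x => ?_⟩⟩
  change weightedSumSquares ℝ _ (star U.1 *ᵥ x) = _
  have hquad := conj (diagonal hA.eigenvalues) x
  have hself := conj 1 x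
  rw [← hspec] at hquad
  rw [mul_one, hone, one_mulVec, one_mulVec] at hself
  rw [toQuadraticForm'_sub_scalar_apply, hquad, hself]
  simp only [weightedSumSquares_apply, dotProduct, mulVec_diagonal, Finset.mul_sum,
    ← Finset.sum_sub_distrib, smul_eq_mul]
  exact Finset.sum_congr rfl fun i _ => by ring

theorem finrank_le_card_eigenvalues_le (hA : A.IsHermitian) {c : ℝ} {W : Submodule ℝ (V → ℝ)}
    (hW : ∀ x ∈ W, x ⬝ᵥ A *ᵥ x ≤ c * (x ⬝ᵥ x)) :
    Module.finrank ℝ W ≤ (Finset.univ.filter fun i => hA.eigenvalues i ≤ c).card := by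
  have hsig := sigPos_add_finrank_le_of_nonpos (Q := (A - scalar V c).toQuadraticForm') (V := W)
    fun x hx => by rw [toQuadraticForm'_sub_scalar_apply]; exact sub_nonpos.mpr (hW x hx)
  rw [sigPos_of_equiv_weightedSumSquares (equivalent_weightedSumSquares_eigenvalues_sub hA c),
    Module.finrank_fintype_fun_eq_card, Set.ncard_eq_toFinset_card'] at hsig
  simp only [sub_pos, Set.toFinset_ofPred] at hsig
  have hcompl := Finset.card_filter_add_card_filter_not (s := Finset.univ)
    fun i => c < hA.eigenvalues i
  simp only [not_lt, Finset.card_univ] at hcompl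
  omega

theorem finrank_le_card_le_eigenvalues (hA : A.IsHermitian) {c : ℝ} {W : Submodule ℝ (V → ℝ)}
    (hW : ∀ x ∈ W, c * (x ⬝ᵥ x) ≤ x ⬝ᵥ A *ᵥ x) :
    Module.finrank ℝ W ≤ (Finset.univ.filter fun i => c ≤ hA.eigenvalues i).card := by
  have hsig := sigPos_add_finrank_le_of_nonpos (Q := -(A - scalar V c).toQuadraticForm') (V := W)
    fun x hx => by
      rw [_root_.neg_apply, toQuadraticForm'_sub_scalar_apply, neg_nonpos]
      exact sub_nonneg.mpr (hW x hx)
  rw [sigPos_neg,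
    sigNeg_of_equiv_weightedSumSquares (equivalent_weightedSumSquares_eigenvalues_sub hA c),
    Module.finrank_fintype_fun_eq_card, Set.ncard_eq_toFinset_card'] at hsig
  simp only [sub_neg, Set.toFinset_ofPred] at hsig
  have hcompl := Finset.card_filter_add_card_filter_not (s := Finset.univ)
    fun i => hA.eigenvalues i < c
  simp only [not_lt, Finset.card_univ] at hcompl
  omega

theorem sum_abs_eigenvalues_sub (hA : A.IsHermitian) (c : ℝ) :
    ∑ i, |hA.eigenvalues i - c| =
      (((A - scalar V c) ^ 2).charpoly.roots.map Real.sqrt).sum := by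
  have hcfc : (A - scalar V c) ^ 2 = cfc (fun x => (x - c) ^ 2) A := by
    have hsa : IsSelfAdjoint A := hA
    rw [cfc_pow (fun x => x - c) 2 A, cfc_sub (fun x => x) (fun _ => c) A, cfc_id' ℝ A,
      cfc_const c A]
    rfl
  rw [hcfc, hA.charpoly_cfc_eq, Polynomial.roots_prod _ _
    (Finset.prod_ne_zero_iff.mpr fun i _ => Polynomial.X_sub_C_ne_zero _)]
  simp only [RCLike.ofReal_real_eq_id, id_eq, Polynomial.roots_X_sub_C, Multiset.map_bind,
    Multiset.map_singleton, Real.sqrt_sq_eq_abs, Multiset.sum_bind, Multiset.sum_singleton]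
  rfl

end Eigenvalues

section LaplacianSpectrum

open Matrix

variable {V W ι : Type*} [Fintype V] [Fintype W] [Fintype ι]

theorem lapEigenvalues_eq [DecidableEq V] (G : SimpleGraph V) [DecidableRel G.Adj] :
    lapEigenvalues G = (G.posSemidef_lapMatrix ℝ).isHermitian.eigenvalues := by
  unfold lapEigenvalues
  congr!

theorem card_le_finrank_ker_add_card (Φ : (V → ℝ) →ₗ[ℝ] ι → ℝ) :
    Fintype.card V ≤ Module.finrank ℝ Φ.ker + Fintype.card ι := by
  have hrange := Submodule.finrank_le Φ.range
  have hsum := Φ.finrank_range_add_finrank_ker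
  simp only [Module.finrank_fintype_fun_eq_card] at hrange hsum
  omega

theorem dotProduct_lapMatrix_mulVec [DecidableEq V] (G : SimpleGraph V) [DecidableRel G.Adj]
    (x : V → ℝ) : x ⬝ᵥ G.lapMatrix ℝ *ᵥ x =
      (∑ p, ∑ q, if G.Adj p q then (x p - x q) ^ 2 else 0) / 2 := by
  rw [← toLinearMap₂'_apply', SimpleGraph.lapMatrix_toLinearMap₂']

theorem card_le_card_lapEigenvalues_le_add_card (G : SimpleGraph V) [DecidableRel G.Adj] {c : ℝ}
    (Φ : (V → ℝ) →ₗ[ℝ] ι → ℝ) (hΦ : ∀ x, Φ x = 0 →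
      (∑ p, ∑ q, if G.Adj p q then (x p - x q) ^ 2 else 0) / 2 ≤ c * ∑ p, x p ^ 2) :
    Fintype.card V ≤
      (Finset.univ.filter fun i => lapEigenvalues G i ≤ c).card + Fintype.card ι := by
  classical
  refine (card_le_finrank_ker_add_card Φ).trans (Nat.add_le_add_right ?_ _)
  rw [lapEigenvalues_eq]
  refine finrank_le_card_eigenvalues_le _ fun x hx => ?_
  rw [dotProduct_lapMatrix_mulVec]
  simpa only [dotProduct, ← pow_two] using hΦ x hx

theorem card_le_card_le_lapEigenvalues_add_card (G : SimpleGraph V) [DecidableRel G.Adj] {c : ℝ}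
    (Φ : (V → ℝ) →ₗ[ℝ] ι → ℝ) (hΦ : ∀ x, Φ x = 0 →
      c * ∑ p, x p ^ 2 ≤ (∑ p, ∑ q, if G.Adj p q then (x p - x q) ^ 2 else 0) / 2) :
    Fintype.card V ≤
      (Finset.univ.filter fun i => c ≤ lapEigenvalues G i).card + Fintype.card ι := by
  classical
  refine (card_le_finrank_ker_add_card Φ).trans (Nat.add_le_add_right ?_ _)
  rw [lapEigenvalues_eq]
  refine finrank_le_card_le_eigenvalues _ fun x hx => ?_
  rw [dotProduct_lapMatrix_mulVec]
  simpa only [dotProduct, ← pow_two] using hΦ x hx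

/-- A set of edges that meets every vertex yields as many linear conditions under which the
Laplacian form is at least `2 ‖x‖²`: on `x p + x q = 0` for the edges `pq` of the cover, every
vertex has a neighbour with the opposite value. -/
theorem card_le_card_two_le_lapEigenvalues_add_card (G : SimpleGraph V) {s t : ι → V}
    (hadj : ∀ e, G.Adj (s e) (t e)) (hcover : ∀ v, ∃ e, v = s e ∨ v = t e) :
    Fintype.card V ≤
      (Finset.univ.filter fun i => 2 ≤ lapEigenvalues G i).card + Fintype.card ι := by
  classical
  refine card_le_card_le_lapEigenvalues_add_card G
    (LinearMap.funLeft ℝ ℝ s + LinearMap.funLeft ℝ ℝ t) fun x hx => ?_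
  have hneighbor (p : V) : ∃ q, G.Adj p q ∧ x q = -x p := by
    obtain ⟨e, rfl | rfl⟩ := hcover p
    · exact ⟨t e, hadj e, eq_neg_of_add_eq_zero_right (congrFun hx e)⟩
    · exact ⟨s e, (hadj e).symm, eq_neg_of_add_eq_zero_left (congrFun hx e)⟩
  have hvertex (p : V) : 4 * x p ^ 2 ≤ ∑ q, if G.Adj p q then (x p - x q) ^ 2 else 0 := by
    obtain ⟨q, hpq, hq⟩ := hneighbor p
    calc 4 * x p ^ 2 = if G.Adj p q then (x p - x q) ^ 2 else 0 := by rw [if_pos hpq, hq]; ring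
      _ ≤ _ := Finset.single_le_sum (f := fun q => if G.Adj p q then (x p - x q) ^ 2 else 0)
          (fun _ _ => by positivity) (Finset.mem_univ q)
  have hsum := Finset.sum_le_sum fun p (_ : p ∈ Finset.univ) => hvertex p
  rw [← Finset.mul_sum] at hsum
  linarith

theorem sum_abs_sub_eq_of_card_le {μ : V → ℝ} {a b : ℝ} {N : ℕ} (hab : a < b)
    (hcard : Fintype.card V = 2 * N)
    (ha : N ≤ (Finset.univ.filter fun i => μ i ≤ a).card)
    (hb : N ≤ (Finset.univ.filter fun i => b ≤ μ i).card) :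
    ∑ i, |μ i - a| = ∑ i, |μ i - b| := by
  have hsub : (Finset.univ.filter fun i => b ≤ μ i) ⊆ Finset.univ.filter fun i => ¬ μ i ≤ a :=
    Finset.monotone_filter_right _ fun i _ hi => not_le.mpr (hab.trans_le hi)
  have hsplit := Finset.card_filter_add_card_filter_not (s := Finset.univ) fun i => μ i ≤ a
  rw [Finset.card_univ, hcard] at hsplit
  have hle := Finset.card_le_card hsub
  have hgap := Finset.eq_of_subset_of_card_le hsub (by omega)
  have hlow : ∑ i with μ i ≤ a, (|μ i - a| - |μ i - b|) = N * (a - b) := by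
    rw [show N = (Finset.univ.filter fun i => μ i ≤ a).card by omega, ← nsmul_eq_mul]
    refine Finset.sum_eq_card_nsmul fun i hi => ?_
    have hi : μ i ≤ a := (Finset.mem_filter.mp hi).2
    rw [abs_of_nonpos (by linarith), abs_of_nonpos (by linarith)]
    ring
  have hhigh : ∑ i with ¬ μ i ≤ a, (|μ i - a| - |μ i - b|) = N * (b - a) := by
    rw [← hgap, show N = (Finset.univ.filter fun i => b ≤ μ i).card by omega, ← nsmul_eq_mul]
    refine Finset.sum_eq_card_nsmul fun i hi => ?_
    have hi : b ≤ μ i := (Finset.mem_filter.mp hi).2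
    rw [abs_of_nonneg (by linarith), abs_of_nonneg (by linarith)]
    ring
  rw [← sub_eq_zero, ← Finset.sum_sub_distrib,
    ← Finset.sum_filter_add_sum_filter_not _ (fun i => μ i ≤ a), hlow, hhigh]
  ring

/-- The Laplacian energy of `G` centred at an arbitrary real number `c` instead of the average
degree, so that graphs with different average degrees can be compared at the same centre. -/
noncomputable def laplacianEnergyAt (G : SimpleGraph V) (c : ℝ) : ℝ :=
  ∑ i, |lapEigenvalues G i - c|

theorem laplacianEnergyAt_eq_sum_sqrt_roots [DecidableEq V] (G : SimpleGraph V)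
    [DecidableRel G.Adj] (c : ℝ) :
    laplacianEnergyAt G c =
      (((G.lapMatrix ℝ - scalar V c) ^ 2).charpoly.roots.map Real.sqrt).sum := by
  rw [laplacianEnergyAt, lapEigenvalues_eq, sum_abs_eigenvalues_sub]

theorem lapMatrix_apply_eq [DecidableEq V] (G : SimpleGraph V) [DecidableRel G.Adj] (p q : V) :
    G.lapMatrix ℝ p q = (if p = q then (G.degree p : ℝ) else 0) - if G.Adj p q then 1 else 0 := by
  simp [SimpleGraph.lapMatrix, SimpleGraph.degMatrix, diagonal_apply, SimpleGraph.adjMatrix_apply]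

theorem lapMatrix_sub_scalar_apply [DecidableEq V] (G : SimpleGraph V) [DecidableRel G.Adj] (c : ℝ)
    (p q : V) : (G.lapMatrix ℝ - scalar V c) p q =
      (if p = q then G.degree p - c else 0) - if G.Adj p q then 1 else 0 := by
  rw [Matrix.sub_apply, lapMatrix_apply_eq, scalar_apply, diagonal_apply]
  split_ifs <;> ring

theorem reindex_lapMatrix [DecidableEq V] [DecidableEq W] {G : SimpleGraph V} {H : SimpleGraph W}
    [DecidableRel G.Adj] [DecidableRel H.Adj] (e : G ≃g H) :
    reindex e.toEquiv e.toEquiv (G.lapMatrix ℝ) = H.lapMatrix ℝ := by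
  ext p q
  obtain ⟨p, rfl⟩ := e.toEquiv.surjective p
  obtain ⟨q, rfl⟩ := e.toEquiv.surjective q
  rw [reindex_apply, submatrix_apply, Equiv.symm_apply_apply, Equiv.symm_apply_apply,
    lapMatrix_apply_eq, lapMatrix_apply_eq]
  simp only [RelIso.coe_fn_toEquiv, e.injective.eq_iff, e.map_adj_iff, e.degree_eq]

theorem laplacianEnergyAt_eq_of_iso {G : SimpleGraph V} {H : SimpleGraph W} (e : G ≃g H) (c : ℝ) :
    laplacianEnergyAt G c = laplacianEnergyAt H c := by
  classical
  have hreindex : H.lapMatrix ℝ - scalar W c =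
      reindexAlgEquiv ℝ ℝ e.toEquiv (G.lapMatrix ℝ - scalar V c) := by
    rw [map_sub, coe_reindexAlgEquiv, reindex_lapMatrix]
    simp [scalar_apply]
  rw [laplacianEnergyAt_eq_sum_sqrt_roots, laplacianEnergyAt_eq_sum_sqrt_roots, hreindex,
    ← map_pow, coe_reindexAlgEquiv, charpoly_reindex]

theorem averageDegree_eq (G : SimpleGraph V) [DecidableRel G.Adj] :
    averageDegree G = (∑ v, (G.degree v : ℝ)) / Fintype.card V := by
  unfold averageDegree
  congr!

theorem averageDegree_eq_of_iso {G : SimpleGraph V} {H : SimpleGraph W} (e : G ≃g H) :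
    averageDegree G = averageDegree H := by
  classical
  rw [averageDegree_eq, averageDegree_eq, Fintype.card_congr e.toEquiv]
  congr 1
  exact Fintype.sum_equiv e.toEquiv _ _ fun v => congrArg Nat.cast (e.degree_eq v).symm

theorem laplacianEnergy_eq_of_iso {G : SimpleGraph V} {H : SimpleGraph W} (e : G ≃g H) :
    laplacianEnergy G = laplacianEnergy H := by
  rw [laplacianEnergy, laplacianEnergy, averageDegree_eq_of_iso e]
  exact laplacianEnergyAt_eq_of_iso e _

end LaplacianSpectrum

section DoubledGraph

open Matrix

variable {I B : Type*}

/-- The graph consisting of two copies of a graph `K`, indexed by `Bool`, and one copy of a graph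
`T` with root `u`, in which `u` is joined to both copies of every vertex in `Y` and the two copies
of every vertex in `Z` are joined to each other. For `Z = ∅` this is `twoCopyGraph`; the index set
of `K` is arbitrary and the copies are indexed uniformly, so that copies can be swapped. -/
def doubledGraph (K : SimpleGraph I) (T : SimpleGraph B) (u : B) (Y Z : Finset I) :
    SimpleGraph ((Bool × I) ⊕ B) where
  Adj
    | .inl (b, i), .inl (c, j) => b = c ∧ K.Adj i j ∨ b ≠ c ∧ i = j ∧ i ∈ Z
    | .inl (_, i), .inr v => v = u ∧ i ∈ Y
    | .inr v, .inl (_, i) => v = u ∧ i ∈ Y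
    | .inr v, .inr w => T.Adj v w
  symm := ⟨by
    rintro (⟨b, i⟩ | v) (⟨c, j⟩ | w) h
    · exact h.imp (fun h => ⟨h.1.symm, h.2.symm⟩)
        fun ⟨hbc, hij, hZ⟩ => ⟨hbc.symm, hij.symm, hij ▸ hZ⟩
    · exact h
    · exact h
    · exact h.symm⟩
  loopless := ⟨by
    rintro (⟨b, i⟩ | v) h
    · exact h.elim (fun h => h.2.ne rfl) fun h => h.1 rfl
    · exact h.ne rfl⟩

variable {K : SimpleGraph I} {T : SimpleGraph B} {u : B} {Y Z : Finset I}

theorem doubledGraph_adj_inl_inl {b c : Bool} {i j : I} :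
    (doubledGraph K T u Y Z).Adj (.inl (b, i)) (.inl (c, j)) ↔
      b = c ∧ K.Adj i j ∨ b ≠ c ∧ i = j ∧ i ∈ Z := Iff.rfl

theorem doubledGraph_adj_inl_inr {b : Bool} {i : I} {v : B} :
    (doubledGraph K T u Y Z).Adj (.inl (b, i)) (.inr v) ↔ v = u ∧ i ∈ Y := Iff.rfl

theorem doubledGraph_adj_inr_inl {b : Bool} {i : I} {v : B} :
    (doubledGraph K T u Y Z).Adj (.inr v) (.inl (b, i)) ↔ v = u ∧ i ∈ Y := Iff.rfl

/-- The permutation exchanging the two copies of every vertex `i` with `s i = true`. -/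
def swapCopies (B : Type*) (s : I → Bool) : Equiv.Perm ((Bool × I) ⊕ B) :=
  Equiv.sumCongr
    (Function.Involutive.toPerm (fun p => (p.1 ^^ s p.2, p.2)) fun p => by simp) (Equiv.refl B)

@[simp]
theorem swapCopies_inl (s : I → Bool) (b : Bool) (i : I) :
    swapCopies B s (.inl (b, i)) = .inl (b ^^ s i, i) := rfl

@[simp]
theorem swapCopies_inr (s : I → Bool) (v : B) : swapCopies B s (.inr v) = .inr v := rfl

theorem degree_eq_sum_ite {V : Type*} [Fintype V] (G : SimpleGraph V) [DecidableRel G.Adj]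
    (v : V) : G.degree v = ∑ w, if G.Adj v w then 1 else 0 := by
  simpa only [Nat.cast_id] using G.degree_eq_sum_if_adj (R := ℕ) v

variable [Fintype I] [Fintype B]

theorem degree_doubledGraph_inl [DecidableRel (doubledGraph K T u Y Z).Adj] [DecidableEq I]
    [DecidableRel K.Adj] (b : Bool) (i : I) :
    (doubledGraph K T u Y Z).degree (.inl (b, i)) =
      K.degree i + (if i ∈ Y then 1 else 0) + if i ∈ Z then 1 else 0 := by
  classical
  have hrest : ∑ v : B, (if (doubledGraph K T u Y Z).Adj (.inl (b, i)) (.inr v) then 1 else 0) =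
      if i ∈ Y then 1 else 0 := by
    simp [doubledGraph_adj_inl_inr, ite_and]
  rw [degree_eq_sum_ite, degree_eq_sum_ite, Fintype.sum_sum_type, Fintype.sum_prod_type, hrest,
    Fintype.sum_bool]
  cases b <;>
    simp only [doubledGraph_adj_inl_inl, ne_eq, Bool.false_eq_true, Bool.true_eq_false,
      not_true_eq_false, not_false_eq_true, true_and, false_and, false_or, or_false, ite_and,
      Finset.sum_ite_eq, Finset.mem_univ, if_true] <;>
    ring

theorem degree_doubledGraph_inr [DecidableRel (doubledGraph K T u Y Z).Adj]
    [DecidableRel (doubledGraph K T u Y ∅).Adj] (v : B) :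
    (doubledGraph K T u Y Z).degree (.inr v) = (doubledGraph K T u Y ∅).degree (.inr v) := by
  simp only [degree_eq_sum_ite, Fintype.sum_sum_type]
  exact congrArg₂ (· + ·) (Finset.sum_congr rfl fun _ _ => if_congr Iff.rfl rfl rfl)
    (Finset.sum_congr rfl fun _ _ => if_congr Iff.rfl rfl rfl)

theorem averageDegree_doubledGraph :
    averageDegree (doubledGraph K T u Y Z) = averageDegree (doubledGraph K T u Y ∅) +
      2 * Z.card / (2 * Fintype.card I + Fintype.card B) := by
  classical
  simp only [averageDegree_eq, Fintype.sum_sum_type, Fintype.sum_prod_type, Fintype.sum_bool,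
    degree_doubledGraph_inl, degree_doubledGraph_inr (Z := Z), Fintype.card_sum, Fintype.card_prod,
    Fintype.card_bool]
  push_cast
  rw [← add_div]
  simp only [Finset.sum_add_distrib, Finset.sum_ite_mem, Finset.univ_inter, Finset.sum_const,
    nsmul_eq_mul, mul_one, Finset.notMem_empty, if_false, add_zero]
  ring

section LapMatrix

variable [DecidableEq I] [DecidableEq B]

theorem lapMatrix_doubledGraph_sub_scalar_inl_inl [DecidableRel (doubledGraph K T u Y Z).Adj]
    [DecidableRel K.Adj] {r : ℕ} {i : I}
    (hr : K.degree i + (if i ∈ Y then 1 else 0) + (if i ∈ Z then 1 else 0) = r) (b c : Bool)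
    (j : I) :
    ((doubledGraph K T u Y Z).lapMatrix ℝ - scalar (Bool × I ⊕ B) (r : ℝ))
        (.inl (b, i)) (.inl (c, j)) =
      -if b = c ∧ K.Adj i j ∨ b ≠ c ∧ i = j ∧ i ∈ Z then 1 else 0 := by
  rw [lapMatrix_sub_scalar_apply, degree_doubledGraph_inl, hr]
  simp only [doubledGraph_adj_inl_inl, sub_self, ite_self, zero_sub]

variable [DecidableRel (doubledGraph K T u Y ∅).Adj]

theorem lapMatrix_doubledGraph_empty_sub_scalar_inl_inl [DecidableRel K.Adj] {r : ℕ} {i : I}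
    (hr : K.degree i + (if i ∈ Y then 1 else 0) + (if i ∈ Z then 1 else 0) = r) (b c : Bool)
    (j : I) :
    ((doubledGraph K T u Y ∅).lapMatrix ℝ - scalar (Bool × I ⊕ B) (r : ℝ))
        (.inl (b, i)) (.inl (c, j)) =
      -if b = c ∧ (K.Adj i j ∨ i = j ∧ i ∈ Z) then 1 else 0 := by
  rw [lapMatrix_sub_scalar_apply, degree_doubledGraph_inl, ← hr]
  rcases eq_or_ne i j with rfl | hij
  · by_cases hbc : b = c <;> by_cases hZ : i ∈ Z <;> simp [doubledGraph_adj_inl_inl, hbc, hZ]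
  · simp [doubledGraph_adj_inl_inl, hij]

theorem submatrix_swapCopies_lapMatrix_doubledGraph [DecidableRel (doubledGraph K T u Y Z).Adj]
    [DecidableRel K.Adj] (C : K.Coloring Bool) {r : ℕ}
    (hr : ∀ i, K.degree i + (if i ∈ Y then 1 else 0) + (if i ∈ Z then 1 else 0) = r) :
    ((doubledGraph K T u Y Z).lapMatrix ℝ - scalar (Bool × I ⊕ B) (r : ℝ)).submatrix
        (swapCopies B C) (swapCopies B C) =
      ((doubledGraph K T u Y ∅).lapMatrix ℝ - scalar (Bool × I ⊕ B) (r : ℝ)).submatrix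
        id (swapCopies B fun _ => true) := by
  ext p q
  rw [submatrix_apply, submatrix_apply, id_eq]
  rcases p with ⟨b, i⟩ | v <;> rcases q with ⟨c, j⟩ | w
  · have hvalid : K.Adj i j → C i ≠ C j := fun h => C.valid h
    rw [swapCopies_inl, swapCopies_inl, swapCopies_inl,
      lapMatrix_doubledGraph_sub_scalar_inl_inl (hr i),
      lapMatrix_doubledGraph_empty_sub_scalar_inl_inl (hr i)]
    congr 2
    rw [eq_iff_iff]
    rcases eq_or_ne i j with rfl | hij
    · cases b <;> cases c <;> simp
    · cases b <;> cases c <;> cases hi : C i <;> cases hj : C j <;> simp_all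
  · simp only [lapMatrix_sub_scalar_apply, swapCopies_inl, swapCopies_inr, doubledGraph_adj_inl_inr,
      reduceCtorEq, if_false]
  · simp only [lapMatrix_sub_scalar_apply, swapCopies_inl, swapCopies_inr, doubledGraph_adj_inr_inl,
      reduceCtorEq, if_false]
  · simp only [lapMatrix_sub_scalar_apply, swapCopies_inr, degree_doubledGraph_inr (Z := Z)]
    exact congrArg _ (if_congr Iff.rfl rfl rfl)

theorem submatrix_swapCopies_lapMatrix_doubledGraph_comm (r : ℝ) :
    ((doubledGraph K T u Y ∅).lapMatrix ℝ - scalar (Bool × I ⊕ B) r).submatrix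
        id (swapCopies B fun _ => true) =
      ((doubledGraph K T u Y ∅).lapMatrix ℝ - scalar (Bool × I ⊕ B) r).submatrix
        (swapCopies B fun _ => true) id := by
  classical
  ext p q
  rw [submatrix_apply, submatrix_apply, id_eq, id_eq]
  rcases p with ⟨b, i⟩ | v <;> rcases q with ⟨c, j⟩ | w <;>
    simp only [lapMatrix_sub_scalar_apply, swapCopies_inl, swapCopies_inr, doubledGraph_adj_inl_inr,
      doubledGraph_adj_inr_inl, reduceCtorEq, if_false]
  cases b <;> cases c <;> simp [doubledGraph_adj_inl_inl, degree_doubledGraph_inl]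

end LapMatrix

/-- With `π` the swap along a colour class and `τ` the exchange of the two copies, adding the edges
at `Z` turns `L - r` into `(L - r) τ` up to conjugation by `π`; as `τ` commutes with `L`, the
squares agree up to conjugation. -/
theorem laplacianEnergyAt_doubledGraph [DecidableEq I] [DecidableRel K.Adj]
    (C : K.Coloring Bool) {r : ℕ}
    (hr : ∀ i, K.degree i + (if i ∈ Y then 1 else 0) + (if i ∈ Z then 1 else 0) = r) :
    laplacianEnergyAt (doubledGraph K T u Y Z) r =
      laplacianEnergyAt (doubledGraph K T u Y ∅) r := by
  classical
  set π := swapCopies B C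
  set τ : Equiv.Perm (Bool × I ⊕ B) := swapCopies B fun _ => true
  set M := (doubledGraph K T u Y ∅).lapMatrix ℝ - scalar _ (r : ℝ) with hM
  set N := (doubledGraph K T u Y Z).lapMatrix ℝ - scalar _ (r : ℝ) with hN
  have hconj : N.submatrix π π = M.submatrix id τ :=
    submatrix_swapCopies_lapMatrix_doubledGraph C hr
  have hcomm : M.submatrix id τ = M.submatrix τ id :=
    submatrix_swapCopies_lapMatrix_doubledGraph_comm _
  have hsq : (N ^ 2).submatrix π π = M ^ 2 :=
    calc (N ^ 2).submatrix π π = N.submatrix π π * N.submatrix π π := by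
          rw [submatrix_mul_equiv, pow_two]
      _ = M.submatrix id τ * M.submatrix τ id := by rw [hconj, ← hcomm]
      _ = M ^ 2 := by rw [submatrix_mul_equiv, submatrix_id_id, pow_two]
  rw [laplacianEnergyAt_eq_sum_sqrt_roots, laplacianEnergyAt_eq_sum_sqrt_roots, ← hM, ← hN, ← hsq,
    ← charpoly_reindex π.symm (N ^ 2)]
  rfl

end DoubledGraph

section TwoCopyGraph

variable {k : ℕ} {B : Type*} {K : SimpleGraph (Fin k)} {T : SimpleGraph B} {u : B}
  {y : Fin k → Fin 2}

/-- The reindexing of the vertices that identifies `doubledGraph` with `twoCopyGraph`. -/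
def copiesEquiv (k : ℕ) (B : Type*) : (Bool × Fin k) ⊕ B ≃ Fin k ⊕ Fin k ⊕ B :=
  ((Equiv.boolProdEquivSum (Fin k)).sumCongr (Equiv.refl B)).trans
    (Equiv.sumAssoc (Fin k) (Fin k) B)

/-- `twoCopyGraph` as a `doubledGraph` without edges between the copies. -/
def doubledGraphIsoTwoCopyGraph :
    doubledGraph K T u {i | y i = 1} ∅ ≃g twoCopyGraph K T u y where
  toEquiv := copiesEquiv k B
  map_rel_iff' := by
    have hK {i j : Fin k} (h : K.Adj i j) : i ≠ j := h.ne
    have hT {v w : B} (h : T.Adj v w) : v ≠ w := h.ne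
    rintro (⟨_ | _, i⟩ | v) (⟨_ | _, j⟩ | w) <;>
      simp +contextual [copiesEquiv, twoCopyGraph, doubledGraph, SimpleGraph.adj_comm, hK, hT]

/-- `twoCopyGraph` with the edges `copyEdges B z` as a `doubledGraph`. -/
def doubledGraphIsoSupCopyEdges (z : Fin k → Fin 2) :
    doubledGraph K T u {i | y i = 1} {i | z i = 1} ≃g twoCopyGraph K T u y ⊔ copyEdges B z where
  toEquiv := copiesEquiv k B
  map_rel_iff' := by
    have hK {i j : Fin k} (h : K.Adj i j) : i ≠ j := h.ne
    have hT {v w : B} (h : T.Adj v w) : v ≠ w := h.ne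
    rintro (⟨_ | _, i⟩ | v) (⟨_ | _, j⟩ | w) <;>
      simp +contextual [copiesEquiv, twoCopyGraph, copyEdges, doubledGraph,
        SimpleGraph.adj_comm, hK, hT]

end TwoCopyGraph

namespace WDecomposition

variable {V : Type*} [Fintype V] {n k : ℕ} {G : SimpleGraph V} (d : WDecomposition n k G)
  (z : Fin k → Fin 2)

/-- The decomposition of `G` extends to one of `d.opE z`. -/
def opEIso : twoCopyGraph d.Gstar d.Gbreve d.root d.y ⊔ copyEdges _ z ≃g d.opE z where
  toEquiv := d.iso.toEquiv
  map_rel_iff' := or_congr d.iso.map_adj_iff SimpleGraph.map_adj_apply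

theorem averageDegree_opE :
    averageDegree (d.opE z) = averageDegree G + 2 * (Finset.univ.filter (z · = 1)).card / n := by
  classical
  have hn : 2 * k + (n - 2 * k) = n := by have := d.root.isLt; omega
  rw [← averageDegree_eq_of_iso (d.opEIso z), ← averageDegree_eq_of_iso d.iso,
    ← averageDegree_eq_of_iso (doubledGraphIsoSupCopyEdges z),
    ← averageDegree_eq_of_iso doubledGraphIsoTwoCopyGraph, averageDegree_doubledGraph,
    Fintype.card_fin, Fintype.card_fin]
  exact_mod_cast congrArg (_ + _ / ·) (congrArg ((↑) : ℕ → ℝ) hn)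

theorem laplacianEnergyAt_opE [DecidableRel d.Gstar.Adj] (C : d.Gstar.Coloring Bool) {r : ℕ}
    (hr : ∀ i, d.Gstar.degree i + (if d.y i = 1 then 1 else 0) + (if z i = 1 then 1 else 0) = r) :
    laplacianEnergyAt (d.opE z) r = laplacianEnergyAt G r := by
  rw [← laplacianEnergyAt_eq_of_iso (d.opEIso z), ← laplacianEnergyAt_eq_of_iso d.iso,
    ← laplacianEnergyAt_eq_of_iso (doubledGraphIsoSupCopyEdges z),
    ← laplacianEnergyAt_eq_of_iso doubledGraphIsoTwoCopyGraph]
  exact laplacianEnergyAt_doubledGraph C fun i => by simpa using hr i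

end WDecomposition

theorem canonicalVector_eq_one_iff {k j : ℕ} {i : Fin k} :
    canonicalVector k j i = 1 ↔ (i : ℕ) + 1 = j := by
  simp [canonicalVector]

theorem card_filter_canonicalVector_eq_one {k j : ℕ} (hj : 1 ≤ j) (hjk : j ≤ k) :
    (Finset.univ.filter (canonicalVector k j · = 1)).card = 1 := by
  refine Finset.card_eq_one.2 ⟨⟨j - 1, by omega⟩, ?_⟩
  ext i
  rw [Finset.mem_filter_univ, canonicalVector_eq_one_iff, Finset.mem_singleton, Fin.ext_iff]
  dsimp only
  omega

theorem degree_pathGraph_add {k : ℕ} [DecidableRel (SimpleGraph.pathGraph k).Adj] (i : Fin k) :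
    (SimpleGraph.pathGraph k).degree i + (if (i : ℕ) + 1 = k then 1 else 0) +
      (if (i : ℕ) + 1 = 1 then 1 else 0) = 2 := by
  have hadj (j : Fin k) : (if (SimpleGraph.pathGraph k).Adj i j then 1 else 0) =
      (if (i : ℕ) + 1 = j then 1 else 0) + if (i : ℕ) = j + 1 then 1 else 0 := by
    simp only [SimpleGraph.pathGraph_adj]
    split_ifs <;> omega
  have hsucc : ∑ j ∈ Finset.range k, (if (i : ℕ) + 1 = j then 1 else 0) +
      (if (i : ℕ) + 1 = k then 1 else 0) = 1 := by
    rw [← Finset.sum_range_succ (fun j => if (i : ℕ) + 1 = j then 1 else 0), Finset.sum_ite_eq,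
      if_pos (Finset.mem_range.2 (by omega))]
  have hpred : ∑ j ∈ Finset.range k, (if (i : ℕ) = j + 1 then 1 else 0) +
      (if (i : ℕ) = 0 then 1 else 0) = 1 := by
    rw [← Finset.sum_range_succ' (fun j => if (i : ℕ) = j then 1 else 0),
      Finset.sum_ite_eq, if_pos (Finset.mem_range.2 (by omega))]
  rw [degree_eq_sum_ite, Finset.sum_congr rfl fun j _ => hadj j, Finset.sum_add_distrib,
    Fin.sum_univ_eq_sum_range fun j => if (i : ℕ) + 1 = j then 1 else 0,
    Fin.sum_univ_eq_sum_range fun j => if (i : ℕ) = j + 1 then 1 else 0]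
  simp only [Nat.add_eq_right]
  omega

theorem WDecomposition.averageDegree_opE_canonicalVector_one {V : Type*} [Fintype V] {n k : ℕ}
    {G : SimpleGraph V} (d : WDecomposition n k G) :
    averageDegree (d.opE (canonicalVector k 1)) = averageDegree G + 2 / n := by
  rw [d.averageDegree_opE, card_filter_canonicalVector_eq_one le_rfl d.k_pos, Nat.cast_one, mul_one]

theorem WDecomposition.IsStarlike.laplacianEnergyAt_opE {V : Type*} [Fintype V] {n k : ℕ}
    {G : SimpleGraph V} {d : WDecomposition n k G} (hd : d.IsStarlike) :
    laplacianEnergyAt (d.opE (canonicalVector k 1)) 2 = laplacianEnergyAt G 2 := by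
  classical
  obtain ⟨hGstar, hy, -⟩ := hd
  refine d.laplacianEnergyAt_opE (r := 2) _ (hGstar ▸ SimpleGraph.pathGraph.bicoloring k)
    fun i => ?_
  simp only [hy, canonicalVector_eq_one_iff]
  convert degree_pathGraph_add i

section BranchEstimate

theorem sq_sub_le_add_mul_div_add_div {p q : ℝ} (hp : 0 < p) (hq : 0 < q) (x y : ℝ) :
    (x - y) ^ 2 ≤ (p + q) * (x ^ 2 / p + y ^ 2 / q) := by
  have hdiff : (p + q) * (x ^ 2 / p + y ^ 2 / q) - (x - y) ^ 2 = (q * x + p * y) ^ 2 / (p * q) := by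
    field_simp
    ring
  have : 0 ≤ (q * x + p * y) ^ 2 / (p * q) := by positivity
  linarith

variable {N : ℝ}

theorem mul_sq_div_add_sq_sub_add_mul_sq_div_le {p q x y : ℝ} (hN : 1 ≤ N) (hp : 1 ≤ p)
    (hq : 1 ≤ q) (hpq : p + q = N + 1) (hxy : q * x = p * y) :
    N * (x ^ 2 / p) + (x - y) ^ 2 + N * (y ^ 2 / q) ≤ (2 - 1 / N) * (x ^ 2 + y ^ 2) := by
  obtain ⟨t, rfl, rfl⟩ : ∃ t, x = p * t ∧ y = q * t :=
    ⟨x / p, by field_simp, by field_simp; linarith⟩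
  have hdiff : (2 - 1 / N) * ((p * t) ^ 2 + (q * t) ^ 2) -
      (N * ((p * t) ^ 2 / p) + (p * t - q * t) ^ 2 + N * ((q * t) ^ 2 / q)) =
      (2 * (p * q) - (N + 1)) * t ^ 2 / N := by
    obtain rfl : q = N + 1 - p := by linarith
    field_simp
    ring
  have hprod : N + 1 ≤ 2 * (p * q) := by nlinarith
  have : 0 ≤ (2 * (p * q) - (N + 1)) * t ^ 2 / N := by
    have := sub_nonneg.2 hprod
    positivity
  linarith

theorem sq_sub_le_mul_sq_div_add_mul_sq_div {X : ℕ → ℝ} (hX0 : X 0 = 0) {m : ℕ} (hmN : m < N) :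
    (X (2 * m) - X (2 * m + 1)) ^ 2 ≤
      N * (X (2 * m) ^ 2 / m) + N * (X (2 * m + 1) ^ 2 / (N - m)) := by
  rcases m.eq_zero_or_pos with rfl | hm
  · have hN : N ≠ 0 := by rintro rfl; simp at hmN
    simp [hX0, mul_div_cancel₀ _ hN]
  · have := sq_sub_le_add_mul_div_add_div (Nat.cast_pos.2 hm) (sub_pos.2 hmN) (X (2 * m))
      (X (2 * m + 1))
    rwa [add_sub_cancel, mul_add] at this

/-- The term `N * (X (2 * m) ^ 2 / m)` is the part of the next difference that is charged in advance
to `X (2 * m)`; it vanishes for `m = 0`. -/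
theorem sum_range_two_mul_sq_sub_add_le {X : ℕ → ℝ} (hX0 : X 0 = 0) (m : ℕ) (hmN : m ≤ N)
    (hX : ∀ l < m, (l + 1) * X (2 * l + 1) = (N - l) * X (2 * l + 2)) :
    ∑ j ∈ Finset.range (2 * m), (X j - X (j + 1)) ^ 2 + N * (X (2 * m) ^ 2 / m) ≤
      (2 - 1 / N) * ∑ j ∈ Finset.range (2 * m), X (j + 1) ^ 2 := by
  induction m with
  | zero => simp
  | succ m ih =>
    push_cast at hmN
    have : (0 : ℝ) ≤ m := m.cast_nonneg
    have hprev := ih (by linarith) fun l hl => hX l (by omega)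
    have hcharge := sq_sub_le_mul_sq_div_add_mul_sq_div hX0 (m := m) (N := N) (by linarith)
    have hpair := mul_sq_div_add_sq_sub_add_mul_sq_div_le (N := N) (by linarith) (by linarith)
      (by linarith) (by ring) (hX m (Nat.lt_succ_self m))
    rw [Nat.mul_succ, Finset.sum_range_succ, Finset.sum_range_succ, Finset.sum_range_succ,
      Finset.sum_range_succ]
    push_cast
    linarith

theorem sum_range_sq_sub_le {N a : ℕ} {X : ℕ → ℝ} (hX0 : X 0 = 0)
    (hX : ∀ m < a / 2, (m + 1) * X (2 * m + 1) = (N - m) * X (2 * m + 2)) (haN : a ≤ 2 * N)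
    (hodd : Odd a → a < N) :
    ∑ j ∈ Finset.range a, (X j - X (j + 1)) ^ 2 ≤
      (2 - 1 / (N : ℝ)) * ∑ j ∈ Finset.range a, X (j + 1) ^ 2 := by
  obtain ⟨m, rfl | rfl⟩ := a.even_or_odd'
  · have hpairs := sum_range_two_mul_sq_sub_add_le hX0 m (N := N)
      (by exact_mod_cast (by omega : m ≤ N)) fun l hl => hX l (by omega)
    have : 0 ≤ N * (X (2 * m) ^ 2 / m) := by positivity
    linarith
  · have hmN : (2 * m + 2 : ℝ) ≤ N := by exact_mod_cast hodd (odd_two_mul_add_one m)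
    have : (0 : ℝ) ≤ m := m.cast_nonneg
    have hpairs := sum_range_two_mul_sq_sub_add_le hX0 m (N := N) (by linarith)
      fun l hl => hX l (by omega)
    have hcharge := sq_sub_le_mul_sq_div_add_mul_sq_div hX0 (m := m) (N := N) (by linarith)
    have hlast : N * (X (2 * m + 1) ^ 2 / (N - m)) ≤ (2 - 1 / (N : ℝ)) * X (2 * m + 1) ^ 2 := by
      have hcoeff : (N : ℝ) / (N - m) ≤ 2 - 1 / N := by
        have hN0 : (0 : ℝ) < N := by linarith
        rw [show 2 - 1 / (N : ℝ) = (2 * N - 1) / N by field_simp,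
          div_le_div_iff₀ (by linarith) hN0]
        nlinarith
      calc N * (X (2 * m + 1) ^ 2 / (N - m)) = N / (N - m) * X (2 * m + 1) ^ 2 := by ring
        _ ≤ _ := by gcongr
    rw [Finset.sum_range_succ, Finset.sum_range_succ]
    linarith

end BranchEstimate

section FromRel

variable {V : Type*} [Fintype V] {R : V → V → Prop} [DecidableRel R]

theorem sum_sum_ite_fromRel_adj [DecidableRel (SimpleGraph.fromRel R).Adj]
    (hR : ∀ p q, R p q → ¬R q p) {f : V → V → ℝ} (hf : ∀ p q, f p q = f q p) :
    ∑ p, ∑ q, (if (SimpleGraph.fromRel R).Adj p q then f p q else 0) =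
      2 * ∑ p, ∑ q, if R p q then f p q else 0 := by
  have hsplit (p q : V) : (if (SimpleGraph.fromRel R).Adj p q then f p q else 0) =
      (if R p q then f p q else 0) + if R q p then f q p else 0 := by
    have hne (h : R p q) : p ≠ q := by rintro rfl; exact hR p p h h
    have hne' (h : R q p) : p ≠ q := by rintro rfl; exact hR p p h h
    have hadj : (SimpleGraph.fromRel R).Adj p q ↔ R p q ∨ R q p := by
      rw [SimpleGraph.fromRel_adj]
      tauto
    rw [hf q p]
    simp only [hadj]
    by_cases hpq : R p q
    · simp [hpq, hR p q hpq]
    · simp [hpq]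
  simp only [hsplit, Finset.sum_add_distrib]
  rw [Finset.sum_comm (f := fun p q => if R q p then f q p else 0)]
  ring

end FromRel

section StarlikeTree

variable {h : ℕ}

/-- The vertex at distance `j ≤ a i` from the centre of `starlikeTree a` on the `i`-th branch. For
`j > a i` the value is the centre again. -/
def branchVertex (a : Fin h → ℕ) (i : Fin h) : ℕ → Option (Σ i : Fin h, Fin (a i))
  | 0 => none
  | j + 1 => if hj : j < a i then some ⟨i, j, hj⟩ else none

/-- The vertex `q` of `starlikeTree a` is not the centre, and `p` is its neighbour on the way to the
centre. -/
def IsParent (a : Fin h → ℕ) (p q : Option (Σ i : Fin h, Fin (a i))) : Prop :=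
  ∃ v, q = some v ∧ p = branchVertex a v.1 v.2

variable {a : Fin h → ℕ} {i : Fin h} {j : ℕ}

theorem branchVertex_succ (hj : j < a i) : branchVertex a i (j + 1) = some ⟨i, j, hj⟩ :=
  dif_pos hj

theorem eq_none_or_eq_branchVertex_succ (p : Option (Σ i : Fin h, Fin (a i))) :
    p = none ∨ ∃ i, ∃ j < a i, p = branchVertex a i (j + 1) := by
  rcases p with _ | ⟨i, j, hj⟩
  · exact .inl rfl
  · exact .inr ⟨i, j, hj, (branchVertex_succ hj).symm⟩

theorem branchVertex_succ_inj {i' : Fin h} {j' : ℕ} (hj : j < a i) (hj' : j' < a i') :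
    branchVertex a i (j + 1) = branchVertex a i' (j' + 1) ↔ i = i' ∧ j = j' := by
  rw [branchVertex_succ hj, branchVertex_succ hj', Option.some_inj]
  constructor
  · intro heq
    obtain ⟨rfl, heq⟩ := Sigma.mk.inj heq
    exact ⟨rfl, congrArg Fin.val (eq_of_heq heq)⟩
  · rintro ⟨rfl, rfl⟩
    rfl

theorem not_isParent_none (p : Option (Σ i : Fin h, Fin (a i))) : ¬IsParent a p none := by
  simp [IsParent]

theorem isParent_branchVertex_succ_iff (hj : j < a i) {p : Option (Σ i : Fin h, Fin (a i))} :
    IsParent a p (branchVertex a i (j + 1)) ↔ p = branchVertex a i j := by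
  simp [IsParent, branchVertex_succ hj]

theorem isParent_none_branchVertex_succ_iff (hj : j < a i) :
    IsParent a none (branchVertex a i (j + 1)) ↔ j = 0 := by
  rw [isParent_branchVertex_succ_iff hj]
  cases j with
  | zero => simp [branchVertex]
  | succ j => simp [branchVertex_succ (Nat.lt_of_succ_lt hj)]

theorem isParent_branchVertex_succ_branchVertex_succ_iff {i' : Fin h} {j' : ℕ} (hj : j < a i)
    (hj' : j' < a i') :
    IsParent a (branchVertex a i (j + 1)) (branchVertex a i' (j' + 1)) ↔ i = i' ∧ j + 1 = j' := by
  rw [isParent_branchVertex_succ_iff hj']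
  cases j' with
  | zero => simp [branchVertex, hj]
  | succ j' => rw [branchVertex_succ_inj hj (Nat.lt_of_succ_lt hj'), add_left_inj]

theorem IsParent.asymm {p q : Option (Σ i : Fin h, Fin (a i))} (hpq : IsParent a p q) :
    ¬IsParent a q p := by
  obtain rfl | ⟨i, j, hj, rfl⟩ := eq_none_or_eq_branchVertex_succ p
  · exact not_isParent_none q
  obtain rfl | ⟨i', j', hj', rfl⟩ := eq_none_or_eq_branchVertex_succ q
  · exact absurd hpq (not_isParent_none _)
  rw [isParent_branchVertex_succ_branchVertex_succ_iff hj hj'] at hpq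
  rw [isParent_branchVertex_succ_branchVertex_succ_iff hj' hj]
  omega

theorem starlikeTree_eq_fromRel (a : Fin h → ℕ) :
    starlikeTree a = SimpleGraph.fromRel (IsParent a) := by
  refine congrArg SimpleGraph.fromRel (funext₂ fun p q => propext ?_)
  rcases p with _ | ⟨i, j, hj⟩ <;> rcases q with _ | ⟨i', j', hj'⟩
  · exact (iff_false_intro (not_isParent_none _)).symm
  · exact (branchVertex_succ hj' ▸ isParent_none_branchVertex_succ_iff hj').symm
  · exact (iff_false_intro (not_isParent_none _)).symm
  · exact (branchVertex_succ hj ▸ branchVertex_succ hj' ▸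
      isParent_branchVertex_succ_branchVertex_succ_iff hj hj').symm

theorem starlikeTree_adj_branchVertex (hj : j < a i) :
    (starlikeTree a).Adj (branchVertex a i j) (branchVertex a i (j + 1)) := by
  have hparent := (isParent_branchVertex_succ_iff hj).2 rfl
  rw [starlikeTree_eq_fromRel, SimpleGraph.fromRel_adj]
  exact ⟨fun heq => hparent.asymm (heq ▸ hparent), .inl hparent⟩

theorem starlikeTree_adj_none_branchVertex_succ_iff (hj : j < a i) :
    (starlikeTree a).Adj none (branchVertex a i (j + 1)) ↔ j = 0 := by
  rw [starlikeTree_eq_fromRel, SimpleGraph.fromRel_adj, isParent_none_branchVertex_succ_iff hj,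
    or_iff_left (not_isParent_none _), branchVertex_succ hj]
  simp only [ne_eq, reduceCtorEq, not_false_eq_true, true_and]

theorem starlikeTree_adj_branchVertex_succ_branchVertex_succ_iff {i' : Fin h} {j' : ℕ}
    (hj : j < a i) (hj' : j' < a i') :
    (starlikeTree a).Adj (branchVertex a i (j + 1)) (branchVertex a i' (j' + 1)) ↔
      i = i' ∧ (j + 1 = j' ∨ j' + 1 = j) := by
  rw [starlikeTree_eq_fromRel, SimpleGraph.fromRel_adj, ne_eq, branchVertex_succ_inj hj hj',
    isParent_branchVertex_succ_branchVertex_succ_iff hj hj',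
    isParent_branchVertex_succ_branchVertex_succ_iff hj' hj]
  omega

theorem le_encard_neighborSet_starlikeTree (ha : ∀ i, 1 ≤ a i) :
    (h : ℕ∞) ≤ ((starlikeTree a).neighborSet none).encard := by
  have hinj : Function.Injective fun i => branchVertex a i 1 := fun i i' heq =>
    ((branchVertex_succ_inj (ha i) (ha i')).1 heq).1
  calc (h : ℕ∞) = (Set.range fun i => branchVertex a i 1).encard := by
        rw [← Set.image_univ, hinj.encard_image, Set.encard_univ, ENat.card_eq_coe_fintype_card,
          Fintype.card_fin]
    _ ≤ _ := Set.encard_le_encard <| Set.range_subset_iff.2 fun i =>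
        starlikeTree_adj_branchVertex (ha i)

theorem sum_eq_add_sum_branchVertex {M : Type*} [AddCommMonoid M]
    (f : Option (Σ i : Fin h, Fin (a i)) → M) :
    ∑ p, f p = f none + ∑ i, ∑ j ∈ Finset.range (a i), f (branchVertex a i (j + 1)) := by
  rw [Fintype.sum_option, Fintype.sum_sigma]
  congr! 2 with i
  rw [Finset.sum_range]
  exact Finset.sum_congr rfl fun j _ => by rw [branchVertex_succ j.2]

theorem sum_sum_ite_starlikeTree_adj [DecidableRel (starlikeTree a).Adj]
    {f : Option (Σ i : Fin h, Fin (a i)) → Option (Σ i : Fin h, Fin (a i)) → ℝ}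
    (hf : ∀ p q, f p q = f q p) :
    ∑ p, ∑ q, (if (starlikeTree a).Adj p q then f p q else 0) =
      2 * ∑ i, ∑ j ∈ Finset.range (a i), f (branchVertex a i j) (branchVertex a i (j + 1)) := by
  classical
  simp only [starlikeTree_eq_fromRel]
  rw [sum_sum_ite_fromRel_adj (fun _ _ => IsParent.asymm) hf, Finset.sum_comm,
    sum_eq_add_sum_branchVertex]
  simp only [not_isParent_none, if_false, Finset.sum_const_zero, zero_add]
  congr! 3 with i _ j hj
  simp only [isParent_branchVertex_succ_iff (Finset.mem_range.1 hj), Finset.sum_ite_eq',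
    Finset.mem_univ, if_true]

theorem card_starlikeTree_vertices (a : Fin h → ℕ) :
    Fintype.card (Option (Σ i : Fin h, Fin (a i))) = ∑ i, a i + 1 := by
  simp only [Fintype.card_option, Fintype.card_sigma, Fintype.card_fin]

theorem sum_degree_starlikeTree (a : Fin h → ℕ) [DecidableRel (starlikeTree a).Adj] :
    ∑ p, ((starlikeTree a).degree p : ℝ) = 2 * ∑ i, (a i : ℝ) := by
  simp only [SimpleGraph.degree_eq_sum_if_adj]
  rw [sum_sum_ite_starlikeTree_adj fun _ _ => rfl]
  simp only [Finset.sum_const, Finset.card_range, nsmul_eq_mul, mul_one]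

variable {N : ℕ}

theorem averageDegree_starlikeTree (hN : ∑ i, a i + 1 = 2 * N) :
    averageDegree (starlikeTree a) = 2 - 1 / (N : ℝ) := by
  classical
  have hN0 : (N : ℝ) ≠ 0 := Nat.cast_ne_zero.2 (by omega)
  have hsum : ∑ i, (a i : ℝ) = 2 * N - 1 := by
    rw [eq_sub_iff_add_eq]
    exact_mod_cast hN
  rw [averageDegree_eq, sum_degree_starlikeTree, card_starlikeTree_vertices, hN, hsum]
  push_cast
  field_simp

/-- The constraints on `x` that balance the two ends of the second, fourth, … edge of each branch so
that both the preceding and the following edge can be charged to them, see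
`mul_sq_div_add_sq_sub_add_mul_sq_div_le`. -/
def branchConstraints (a : Fin h → ℕ) (N : ℕ) : (Option (Σ i : Fin h, Fin (a i)) → ℝ) →ₗ[ℝ]
    Option (Σ i : Fin h, Fin (a i / 2)) → ℝ :=
  LinearMap.pi fun
    | none => LinearMap.proj none
    | some ⟨i, m⟩ => (m + 1 : ℝ) • LinearMap.proj (branchVertex a i (2 * m + 1)) -
        (N - m : ℝ) • LinearMap.proj (branchVertex a i (2 * m + 2))

theorem sum_starlikeTree_adj_sq_sub_le [DecidableRel (starlikeTree a).Adj]
    (haN : ∀ i, a i ≤ 2 * N) (hodd : ∀ i, Odd (a i) → a i < N)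
    {x : Option (Σ i : Fin h, Fin (a i)) → ℝ} (hx : branchConstraints a N x = 0) :
    (∑ p, ∑ q, if (starlikeTree a).Adj p q then (x p - x q) ^ 2 else 0) / 2 ≤
      (2 - 1 / (N : ℝ)) * ∑ p, x p ^ 2 := by
  have hcentre : x none = 0 := congrFun hx none
  have hbranch (i : Fin h) : ∀ m < a i / 2,
      (m + 1) * x (branchVertex a i (2 * m + 1)) = (N - m) * x (branchVertex a i (2 * m + 2)) :=
    fun m hm => sub_eq_zero.1 (congrFun hx (some ⟨i, m, hm⟩))
  rw [sum_sum_ite_starlikeTree_adj fun p q => sub_sq_comm (x p) (x q), sum_eq_add_sum_branchVertex,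
    hcentre, mul_div_cancel_left₀ _ two_ne_zero, zero_pow two_ne_zero, zero_add, Finset.mul_sum]
  exact Finset.sum_le_sum fun i _ =>
    sum_range_sq_sub_le hcentre (hbranch i) (haN i) (hodd i)

variable {l : Fin h}

theorem two_mul_card_option_sigma_half (hl : Odd (a l)) (he : ∀ i, i ≠ l → Even (a i)) :
    2 * Fintype.card (Option (Σ i : Fin h, Fin (a i / 2))) = ∑ i, a i + 1 := by
  have hmod : ∑ i, a i % 2 = 1 := by
    rw [Fintype.sum_eq_single l fun i hi => Nat.even_iff.1 (he i hi), Nat.odd_iff.1 hl]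
  have hdiv : ∑ i, a i = 2 * ∑ i, a i / 2 + ∑ i, a i % 2 := by
    rw [Finset.mul_sum, ← Finset.sum_add_distrib]
    exact Finset.sum_congr rfl fun i _ => (Nat.div_add_mod _ _).symm
  rw [card_starlikeTree_vertices]
  omega

theorem le_card_lapEigenvalues_starlikeTree_le (hl : Odd (a l)) (he : ∀ i, i ≠ l → Even (a i))
    (hN : ∑ i, a i + 1 = 2 * N) (hlN : a l < N) :
    N ≤ (Finset.univ.filter fun p => lapEigenvalues (starlikeTree a) p ≤ 2 - 1 / (N : ℝ)).card := by
  classical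
  have haN (i : Fin h) : a i ≤ 2 * N :=
    (Finset.single_le_sum (fun _ _ => Nat.zero_le _) (Finset.mem_univ i)).trans (by omega)
  have hodd (i : Fin h) (hi : Odd (a i)) : a i < N := by
    obtain rfl : i = l := by_contra fun hil => Nat.not_even_iff_odd.2 hi (he i hil)
    exact hlN
  have hcount := card_le_card_lapEigenvalues_le_add_card (starlikeTree a) (branchConstraints a N)
    fun x hx => sum_starlikeTree_adj_sq_sub_le haN hodd hx
  have hcard := two_mul_card_option_sigma_half hl he
  rw [card_starlikeTree_vertices a] at hcount
  omega

/-- The edges cover each even branch by itself, and the odd branch together with the centre. -/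
theorem le_card_two_le_lapEigenvalues_starlikeTree (hl : Odd (a l))
    (he : ∀ i, i ≠ l → Even (a i)) (hN : ∑ i, a i + 1 = 2 * N) :
    N ≤ (Finset.univ.filter fun p => 2 ≤ lapEigenvalues (starlikeTree a) p).card := by
  let s : Option (Σ i : Fin h, Fin (a i / 2)) → Option (Σ i : Fin h, Fin (a i))
    | none => branchVertex a l 0
    | some ⟨i, m⟩ => branchVertex a i (2 * m + a i % 2 + 1)
  let t : Option (Σ i : Fin h, Fin (a i / 2)) → Option (Σ i : Fin h, Fin (a i))
    | none => branchVertex a l 1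
    | some ⟨i, m⟩ => branchVertex a i (2 * m + a i % 2 + 2)
  have hadj : ∀ e, (starlikeTree a).Adj (s e) (t e) := by
    rintro (_ | ⟨i, m, hm⟩)
    · exact starlikeTree_adj_branchVertex hl.pos
    · exact starlikeTree_adj_branchVertex (show 2 * m + a i % 2 + 1 < a i by omega)
  have hcover (p : Option (Σ i : Fin h, Fin (a i))) : ∃ e, p = s e ∨ p = t e := by
    obtain rfl | ⟨i, j, hj, rfl⟩ := eq_none_or_eq_branchVertex_succ p
    · exact ⟨none, .inl rfl⟩
    obtain hji | hij := lt_or_ge j (a i % 2)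
    · obtain rfl : i = l := by_contra fun hil => by have := Nat.even_iff.1 (he i hil); omega
      obtain rfl : j = 0 := by omega
      exact ⟨none, .inr rfl⟩
    · obtain ⟨m, hm⟩ := (j - a i % 2).even_or_odd'
      exact ⟨some ⟨i, m, by omega⟩, hm.imp
        (fun hm => congrArg (branchVertex a i) (show j + 1 = 2 * m + a i % 2 + 1 by omega))
        fun hm => congrArg (branchVertex a i) (show j + 1 = 2 * m + a i % 2 + 2 by omega)⟩
  have hcount := card_le_card_two_le_lapEigenvalues_add_card (starlikeTree a) hadj hcover
  have hcard := two_mul_card_option_sigma_half hl he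
  rw [card_starlikeTree_vertices a] at hcount
  omega

theorem laplacianEnergy_starlikeTree (hl : Odd (a l)) (he : ∀ i, i ≠ l → Even (a i))
    (hN : ∑ i, a i + 1 = 2 * N) (hlN : a l < N) :
    laplacianEnergy (starlikeTree a) = laplacianEnergyAt (starlikeTree a) 2 := by
  rw [laplacianEnergy, averageDegree_starlikeTree hN]
  refine sum_abs_sub_eq_of_card_le ?_ ((card_starlikeTree_vertices a).trans hN)
    (le_card_lapEigenvalues_starlikeTree_le hl he hN hlN)
    (le_card_two_le_lapEigenvalues_starlikeTree hl he hN)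
  have : (0 : ℝ) < 1 / N := one_div_pos.2 (Nat.cast_pos.2 (by omega))
  linarith

end StarlikeTree

section Decomposition

/-- A graph whose vertex set splits into two copies of `K` and a set meeting them only at edges from
one vertex `u` to both copies of each vertex in `Y`, as a `doubledGraph`. -/
def doubledGraphIsoOfEquiv {I B V : Type*} {G : SimpleGraph V} {K : SimpleGraph I} {u : B}
    {Y : Finset I} (e : (Bool × I) ⊕ B ≃ V)
    (hcopies : ∀ b i c j, G.Adj (e (.inl (b, i))) (e (.inl (c, j))) ↔ b = c ∧ K.Adj i j)
    (hrest : ∀ b i v, G.Adj (e (.inl (b, i))) (e (.inr v)) ↔ v = u ∧ i ∈ Y) :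
    doubledGraph K (G.comap (e ∘ .inr)) u Y ∅ ≃g G where
  toEquiv := e
  map_rel_iff' := by
    rintro (⟨b, i⟩ | v) (⟨c, j⟩ | w)
    · simp [doubledGraph_adj_inl_inl, hcopies]
    · exact hrest b i w
    · exact G.adj_comm _ _ |>.trans (hrest c j v)
    · exact Iff.rfl

theorem exists_wDecomposition {V : Type*} [Fintype V] {n k : ℕ} {G : SimpleGraph V}
    (hn : Fintype.card V = n) (hk : 0 < k) {K : SimpleGraph (Fin k)} {y : Fin k → Fin 2}
    {f : Bool × Fin k → V} (hf : Function.Injective f) {r : V} (hr : r ∉ Set.range f)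
    (hcopies : ∀ b i c j, G.Adj (f (b, i)) (f (c, j)) ↔ b = c ∧ K.Adj i j)
    (hrest : ∀ b i, ∀ p ∉ Set.range f, G.Adj (f (b, i)) p ↔ p = r ∧ y i = 1) :
    ∃ d : WDecomposition n k G, d.Gstar = K ∧ d.y = y ∧ d.iso (.inr (.inr d.root)) = r := by
  classical
  have hcard : Fintype.card ↥(Set.range f)ᶜ = n - 2 * k := by
    rw [Fintype.card_compl_set, hn, Set.card_range_of_injective hf, Fintype.card_prod,
      Fintype.card_bool, Fintype.card_fin]
  let eB : Fin (n - 2 * k) ≃ ↥(Set.range f)ᶜ := (Fintype.equivFinOfCardEq hcard).symm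
  let e : (Bool × Fin k) ⊕ Fin (n - 2 * k) ≃ V :=
    ((Equiv.ofInjective f hf).sumCongr eB).trans (Equiv.Set.sumCompl (Set.range f))
  let u : Fin (n - 2 * k) := eB.symm ⟨r, hr⟩
  have hu (v : Fin (n - 2 * k)) : (eB v : V) = r ↔ v = u := by
    rw [Equiv.eq_symm_apply, Subtype.ext_iff]
  let iso : doubledGraph K (G.comap (e ∘ .inr)) u {i | y i = 1} ∅ ≃g G :=
    doubledGraphIsoOfEquiv e hcopies fun b i v => by
      rw [Finset.mem_filter_univ, ← hu]
      exact hrest b i _ (eB v).2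
  exact ⟨⟨hk, K, G.comap (e ∘ .inr), u, y, doubledGraphIsoTwoCopyGraph.symm.trans iso⟩, rfl, rfl,
    (hu u).2 rfl⟩

theorem WDecomposition.IsStarlike.exists_of_iso {V W : Type*} {n k : ℕ} {G : SimpleGraph V}
    {H : SimpleGraph W} {d : WDecomposition n k G} (hd : d.IsStarlike) (e : G ≃g H) :
    ∃ d : WDecomposition n k H, d.IsStarlike := by
  refine ⟨{ d with iso := d.iso.trans e }, hd.1, hd.2.1, hd.2.2.trans_eq ?_⟩
  exact Set.encard_congr (e.mapNeighborSet _)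

variable {h n k : ℕ} {a : Fin h → ℕ}

/-- The labels of the path increase towards the centre, hence the reversal. -/
theorem exists_wDecomposition_starlikeTree (hn : ∑ i, a i + 1 = n) (hk : 0 < k)
    {c : Bool → Fin h} (hcinj : Function.Injective c) (hc : ∀ b, a (c b) = k) :
    ∃ d : WDecomposition n k (starlikeTree a), d.Gstar = SimpleGraph.pathGraph k ∧
      d.y = canonicalVector k k ∧ d.iso (.inr (.inr d.root)) = none := by
  have hlt (b : Bool) (j : Fin k) : (j.rev : ℕ) < a (c b) := (hc b).symm ▸ j.rev.isLt
  let f : Bool × Fin k → Option (Σ i : Fin h, Fin (a i)) :=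
    fun p => branchVertex a (c p.1) (p.2.rev + 1)
  have hf : Function.Injective f := by
    rintro ⟨b, j⟩ ⟨b', j'⟩ heq
    obtain ⟨hb, hj⟩ := (branchVertex_succ_inj (hlt b j) (hlt b' j')).1 heq
    exact Prod.ext (hcinj hb) (Fin.rev_injective (Fin.ext hj))
  have hr : none ∉ Set.range f := by
    rintro ⟨⟨b, j⟩, heq⟩
    exact Option.some_ne_none _ ((branchVertex_succ (hlt b j)).symm.trans heq)
  refine exists_wDecomposition ((card_starlikeTree_vertices a).trans hn) hk hf hr ?_ ?_
  · intro b j b' j'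
    rw [starlikeTree_adj_branchVertex_succ_branchVertex_succ_iff (hlt b j) (hlt b' j'),
      hcinj.eq_iff, SimpleGraph.pathGraph_adj, Fin.val_rev, Fin.val_rev]
    exact and_congr_right fun _ => by omega
  · intro b j p hp
    obtain rfl | ⟨i, l, hl, rfl⟩ := eq_none_or_eq_branchVertex_succ p
    · rw [SimpleGraph.adj_comm, starlikeTree_adj_none_branchVertex_succ_iff (hlt b j),
        canonicalVector_eq_one_iff, Fin.val_rev, and_iff_right rfl]
      omega
    · rw [starlikeTree_adj_branchVertex_succ_branchVertex_succ_iff (hlt b j) hl,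
        branchVertex_succ hl]
      refine iff_of_false ?_ fun hnone => Option.some_ne_none _ hnone.1
      rintro ⟨rfl, -⟩
      refine hp ⟨(b, Fin.rev ⟨l, hc b ▸ hl⟩), ?_⟩
      simp only [f, Fin.rev_rev]

theorem exists_isStarlike_starlikeTree (hh : 3 ≤ h) (ha : ∀ i, 1 ≤ a i) (hn : ∑ i, a i + 1 = n)
    (hk : 0 < k) {i i' : Fin h} (hne : i ≠ i') (hi : a i = k) (hi' : a i' = k) :
    ∃ d : WDecomposition n k (starlikeTree a), d.IsStarlike := by
  obtain ⟨d, hK, hy, hroot⟩ := exists_wDecomposition_starlikeTree hn hk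
    (c := fun b => bif b then i' else i) (Bool.injective_iff.2 hne) (Bool.forall_bool.2 ⟨hi, hi'⟩)
  refine ⟨d, hK, hy, hroot ▸ ?_⟩
  exact (Nat.cast_lt.2 hh).trans_le (le_encard_neighborSet_starlikeTree ha)

end Decomposition

section MemS

variable {V : Type*} [Fintype V] {n k : ℕ} {G : SimpleGraph V}

theorem MemS.exists_isStarlike (hG : MemS n k G) : ∃ d : WDecomposition n k G, d.IsStarlike := by
  obtain ⟨hcard, hk, h, hh, a, ha, -, h0, h1, -, -, ⟨e⟩⟩ := hG
  have hn : ∑ i, a i + 1 = n := by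
    rw [← card_starlikeTree_vertices, Fintype.card_congr e.toEquiv, hcard]
  obtain ⟨d, hd⟩ := exists_isStarlike_starlikeTree hh ha hn (two_pos.trans_le hk)
    (Fin.ne_of_val_ne zero_ne_one) h0 h1
  exact hd.exists_of_iso e

theorem MemS.exists_starlikeTree_iso (hG : MemS n k G) :
    ∃ (h : ℕ) (a : Fin h → ℕ) (l : Fin h) (N : ℕ), Odd (a l) ∧ (∀ i, i ≠ l → Even (a i)) ∧
      ∑ i, a i + 1 = 2 * N ∧ n = 2 * N ∧ a l < N ∧ Nonempty (starlikeTree a ≃g G) := by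
  obtain ⟨hcard, -, h, hh, a, -, heven, -, -, hl, hlt, ⟨e⟩⟩ := hG
  have hn : ∑ i, a i + 1 = n := by
    rw [← card_starlikeTree_vertices, Fintype.card_congr e.toEquiv, hcard]
  have he (i : Fin h) (hi : i ≠ ⟨h - 1, by omega⟩) : Even (a i) :=
    heven i (by have := Fin.val_ne_of_ne hi; simp only at this; omega)
  have hN := (two_mul_card_option_sigma_half hl he).symm
  refine ⟨h, a, _, _, hl, he, hN, hn.symm.trans hN, ?_, ⟨e⟩⟩
  rw [← hn, hN, Nat.cast_mul, Nat.cast_two, mul_div_cancel_left₀ _ two_ne_zero] at hlt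
  exact_mod_cast hlt

theorem MemS.averageDegree_add (hG : MemS n k G) : averageDegree G + 2 / n = 2 := by
  obtain ⟨h, a, l, N, -, -, hN, rfl, -, ⟨e⟩⟩ := hG.exists_starlikeTree_iso
  rw [← averageDegree_eq_of_iso e, averageDegree_starlikeTree hN]
  push_cast
  rw [div_mul_cancel_left₀ two_ne_zero, one_div, sub_add_cancel]

theorem MemS.laplacianEnergy_eq (hG : MemS n k G) : laplacianEnergy G = laplacianEnergyAt G 2 := by
  obtain ⟨h, a, l, N, hl, he, hN, -, hlN, ⟨e⟩⟩ := hG.exists_starlikeTree_iso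
  rw [← laplacianEnergy_eq_of_iso e, laplacianEnergy_starlikeTree hl he hN hlN,
    laplacianEnergyAt_eq_of_iso e]

end MemS

theorem mainTheorem4 {V : Type*} [Fintype V] (n k : ℕ) (G : SimpleGraph V) (hG : MemS n k G) :
    (∃ d : WDecomposition n k G, d.IsStarlike) ∧
    ∀ d : WDecomposition n k G, d.IsStarlike →
      laplacianEnergy G = laplacianEnergy (d.opE (canonicalVector k 1)) := by
  refine ⟨hG.exists_isStarlike, fun d hd => ?_⟩
  have hdegree : averageDegree (d.opE (canonicalVector k 1)) = 2 := by
    rw [d.averageDegree_opE_canonicalVector_one, hG.averageDegree_add]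
  calc laplacianEnergy G = laplacianEnergyAt G 2 := hG.laplacianEnergy_eq
    _ = laplacianEnergyAt (d.opE (canonicalVector k 1)) 2 := hd.laplacianEnergyAt_opE.symm
    _ = laplacianEnergy (d.opE (canonicalVector k 1)) := by
      rw [laplacianEnergy, hdegree, laplacianEnergyAt]
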